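/- Let $(\mathbf{E},\mathcal{E},m)$ be a measure space, let $L^2(m)$ be the real Hilbert space of square integrable functions on it with inner product $(f,g)=\int_{\mathbf E} fg\,dm$, and let $(P_t)_{t\ge 0}$ be a strongly continuous symmetric sub-Markovian semigroup on $L^2(m)$: the $P_t$ are bounded linear operators with $P_0=I$, $P_{s+t}=P_sP_t$, $P_tf\to f$ in $L^2(m)$ as $t\downarrow 0$, $(P_tf,g)=(f,P_tg)$, and $0\le P_tf\le 1$ $m$-a.e. whenever $0\le f\le 1$ $m$-a.e. Let $A f=\lim_{t\downarrow 0}(P_tf-f)/t$ be its generator, with domain the set of all $f\in L^2(m)$ for which the limit exists in $L^2(m)$, and let $(E_\lambda)_{0\le\lambda<\infty}$ be the spectral family of $-A$; that is, the $E_\lambda$ are orthogonal projections of $L^2(m)$ with $E_\lambda E_\mu=E_\lambda$ for $\lambda\le\mu$, $\lambda\mapsto E_\lambda f$ is right continuous and $\lim_{\lambda\to\infty}E_\lambda f=f$ for every $f\in L^2(m)$, and $-A=\int_0^\infty\lambda\,dE_\lambda$. Here $\int_0^\infty\phi(\lambda)\,dE_\lambda$ is the operator $T$ with domain $\{f:\int_{[0,\infty)}\phi(\lambda)^2\,d(E_\lambda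 f,f)<\infty\}$ and $(Tf,g)=\int_{[0,\infty)}\phi(\lambda)\,d(E_\lambda f,g)$ for $f,g$ in this domain, where $d(E_\lambda f,f)$ gives $[0,\lambda]$ the mass $(E_\lambda f,f)$. For $\alpha>0$ and $t\ge 0$ put $$\mathcal{J}^\alpha_t f:=\int_0^\infty J_0(2\sqrt{ts})\,e^{-\alpha s}P_sf\,ds,\qquad f\in L^2(m),$$ where $J_0(x)=\sum_{k\ge 0}\frac{(-1)^k}{(k!)^2}(x/2)^{2k}$ is the Bessel function of the first kind of order $0$. Then, for every $\alpha>0$: 1. For every $t\ge 0$ the integral exists as a Bochner integral for every $f\in L^2(m)$, and $\mathcal{J}^\alpha_t$ is a bounded, self-adjoint and non-negative operator on the whole of $L^2(m)$, with the spectral resolution $$\mathcal{J}^\alpha_t=\int_0^\infty\frac{1}{\lambda+\alpha}\,e^{-\frac{t}{\lambda+\alpha}}\,dE_\lambda .$$ 2. For every $f\in L^2(m)$ the map $t\mapsto(\mathcal{J}^\alpha_tf,f)$ is convex and non-increasing on $[0,\infty)$, and tends to $0$ as $t\to\infty$. -/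

import Mathlib

open MeasureTheory Filter Topology Set
open scoped ENNReal

noncomputable section

/-- The Bessel function of the first kind of order `0` on the real line,
`J₀(x) = ∑ (-1)^k / (k!)² (x/2)^(2k)` (the series converges absolutely for every `x`). -/
def besselJ0 (x : ℝ) : ℝ :=
  ∑' k : ℕ, (-1 : ℝ) ^ k / (Nat.factorial k : ℝ) ^ 2 * (x / 2) ^ (2 * k)

/-- The real Hilbert space `L²(m)`. -/
abbrev L2 {X : Type*} [MeasurableSpace X] (m : Measure X) : Type _ := Lp ℝ 2 m

/-- `P` (only its values at times `t ≥ 0` matter) is a strongly continuous symmetric sub-Markovian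
semigroup of bounded operators on `L²(m)`. -/
structure IsSymmetricSubMarkovSemigroup {X : Type*} [MeasurableSpace X] (m : Measure X)
    (P : ℝ → L2 m →L[ℝ] L2 m) : Prop where
  zero : P 0 = 1
  add : ∀ s t : ℝ, 0 ≤ s → 0 ≤ t → P (s + t) = P s * P t
  strong_continuous : ∀ f : L2 m, Tendsto (fun t : ℝ => P t f) (𝓝[>] 0) (𝓝 f)
  symmetric : ∀ t : ℝ, 0 ≤ t → ∀ f g : L2 m, inner ℝ (P t f) g = inner ℝ f (P t g)
  sub_markov : ∀ t : ℝ, 0 ≤ t → ∀ f : L2 m,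
    (∀ᵐ x ∂m, 0 ≤ f x ∧ f x ≤ 1) → ∀ᵐ x ∂m, 0 ≤ P t f x ∧ P t f x ≤ 1

/-- The infinitesimal generator of a family `P` of operators:
`A f = lim_{t ↓ 0} (P_t f - f) / t`, with domain the set of all `f` for which the limit exists. -/
def generator {H : Type*} [NormedAddCommGroup H] [NormedSpace ℝ H] (P : ℝ → H →L[ℝ] H) :
    H →ₗ.[ℝ] H where
  domain :=
    { carrier := {f | ∃ g, Tendsto (fun t : ℝ => t⁻¹ • (P t f - f)) (𝓝[>] 0) (𝓝 g)}
      add_mem' := by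
        rintro f₁ f₂ ⟨g₁, h₁⟩ ⟨g₂, h₂⟩
        refine ⟨g₁ + g₂, (h₁.add h₂).congr fun t => ?_⟩
        rw [map_add, ← smul_add]
        congr 1
        abel
      zero_mem' := ⟨0, by simp⟩
      smul_mem' := by
        rintro c f ⟨g, h⟩
        refine ⟨c • g, (h.const_smul c).congr fun t => ?_⟩
        rw [map_smul, ← smul_sub, smul_comm] }
  toFun :=
    { toFun := fun f => Classical.choose f.2
      map_add' := by
        intro f₁ f₂
        refine tendsto_nhds_unique (Classical.choose_spec (f₁ + f₂).2)
          (((Classical.choose_spec f₁.2).add (Classical.choose_spec f₂.2)).congr fun t => ?_)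
        rw [← smul_add, Submodule.coe_add, map_add]
        congr 1
        abel
      map_smul' := by
        intro c f
        refine tendsto_nhds_unique (Classical.choose_spec (c • f).2)
          (((Classical.choose_spec f.2).const_smul c).congr fun t => ?_)
        rw [Submodule.coe_smul, map_smul, ← smul_sub, smul_comm] }

/-- A spectral family `(E_l)_{0 ≤ l < ∞}` of orthogonal projections of a Hilbert space `H`
(only the values at `l ≥ 0` matter). -/
structure SpectralFamily (H : Type*) [NormedAddCommGroup H] [InnerProductSpace ℝ H]
    [CompleteSpace H] where
  proj : ℝ → H →L[ℝ] H
  isStarProjection : ∀ l : ℝ, 0 ≤ l → IsStarProjection (proj l)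
  mul_eq : ∀ l u : ℝ, 0 ≤ l → l ≤ u → proj l * proj u = proj l
  right_continuous : ∀ (f : H) (l : ℝ), 0 ≤ l →
    ContinuousWithinAt (fun u => proj u f) (Ici l) l
  tendsto_atTop : ∀ f : H, Tendsto (fun l => proj l f) atTop (𝓝 f)

namespace SpectralFamily

variable {H : Type*} [NormedAddCommGroup H] [InnerProductSpace ℝ H] [CompleteSpace H]

theorem inner_eq (E : SpectralFamily H) {l : ℝ} (hl : 0 ≤ l) (f : H) :
    inner ℝ (E.proj l f) f = ‖E.proj l f‖ ^ 2 := by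
  have h := E.isStarProjection l hl
  have h1 : E.proj l (E.proj l f) = E.proj l f := congrArg (fun T => T f) h.isIdempotentElem
  have h2 := (ContinuousLinearMap.isSelfAdjoint_iff_isSymmetric.1 h.isSelfAdjoint) (E.proj l f) f
  simp only [ContinuousLinearMap.coe_coe] at h2
  rw [h1] at h2
  rw [h2, real_inner_self_eq_norm_sq]

theorem norm_apply_le (E : SpectralFamily H) {l : ℝ} (hl : 0 ≤ l) (f : H) :
    ‖E.proj l f‖ ≤ ‖f‖ := by
  have h := real_inner_le_norm (E.proj l f) f
  rw [E.inner_eq hl] at h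
  by_contra! hlt
  nlinarith [norm_nonneg f, norm_nonneg (E.proj l f)]

theorem inner_mono (E : SpectralFamily H) {l u : ℝ} (hl : 0 ≤ l) (hlu : l ≤ u) (f : H) :
    inner ℝ (E.proj l f) f ≤ inner ℝ (E.proj u f) f := by
  have h1 : E.proj l (E.proj u f) = E.proj l f := congrArg (fun T => T f) (E.mul_eq l u hl hlu)
  rw [E.inner_eq hl, E.inner_eq (hl.trans hlu), ← h1]
  exact pow_le_pow_left₀ (norm_nonneg _) (E.norm_apply_le hl _) 2

/-- The distribution function `l ↦ (E_l f, f)`, extended by `0` to `l < 0`. -/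
def distribution (E : SpectralFamily H) (f : H) : StieltjesFunction ℝ where
  toFun l := if 0 ≤ l then inner ℝ (E.proj l f) f else 0
  mono' := by
    intro l u hlu
    dsimp only
    split_ifs with h1 h2 h2
    · exact E.inner_mono h1 hlu f
    · exact absurd (h1.trans hlu) h2
    · rw [E.inner_eq h2]; positivity
    · exact le_rfl
  right_continuous' := by
    intro l
    by_cases hl : 0 ≤ l
    · refine ((E.right_continuous f l hl).inner (𝕜 := ℝ)
        (continuousWithinAt_const (b := f))).congr (fun u hu => ?_) ?_
      · exact if_pos (hl.trans hu)
      · exact if_pos hl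
    · push Not at hl
      refine ContinuousAt.continuousWithinAt ?_
      refine (continuousAt_const (y := (0 : ℝ))).congr ?_
      filter_upwards [Iio_mem_nhds hl] with u hu
      exact (if_neg (not_le.2 hu)).symm

/-- The measure `d(E_l f, f)`, carried by `[0, ∞)`. It gives `[0, l]` the mass `(E_l f, f)`; in
particular it has the mass `(E_0 f, f)` at the point `0`. -/
def measure (E : SpectralFamily H) (f : H) : Measure ℝ := (E.distribution f).measure

/-- `∫ φ(l) d(E_l f, g)` over `[0, ∞)`, where `d(E_l f, g)` is given by polarisation,
`d(E_l f, g) = (d(E_l (f + g), f + g) - d(E_l (f - g), f - g)) / 4`. -/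
def weakIntegral (E : SpectralFamily H) (φ : ℝ → ℝ) (f g : H) : ℝ :=
  (∫ l, φ l ∂(E.measure (f + g)) - ∫ l, φ l ∂(E.measure (f - g))) / 4

/-- `T = ∫ φ(l) dE_l`: the domain of `T` is `{f | ∫ φ(l)² d(E_l f, f) < ∞}`, and
`(T f, g) = ∫ φ(l) d(E_l f, g)` for all `f`, `g` in this domain. (The domain is a dense subspace,
so that this determines `T f`; and `φ` is integrable for the finite measures
`d(E_l (f ± g), f ± g)` because it is square integrable for them.) -/
def HasResolution (E : SpectralFamily H) (φ : ℝ → ℝ) (T : H →ₗ.[ℝ] H) : Prop :=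
  (∀ f : H, f ∈ T.domain ↔ MemLp φ 2 (E.measure f)) ∧
    ∀ f g : T.domain, inner ℝ (T f) (g : H) = E.weakIntegral φ (f : H) (g : H)

end SpectralFamily

/-- The function `s ↦ J₀(2 √(t s)) e^{-α s} P_s f`. -/
def besselIntegrand {H : Type*} [NormedAddCommGroup H] [NormedSpace ℝ H] (P : ℝ → H →L[ℝ] H)
    (α t : ℝ) (f : H) (s : ℝ) : H :=
  (besselJ0 (2 * √(t * s)) * Real.exp (-α * s)) • P s f

/-- `𝒥^α_t f = ∫_0^∞ J₀(2 √(t s)) e^{-α s} P_s f ds`, a Bochner integral. -/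
def besselTransform {H : Type*} [NormedAddCommGroup H] [NormedSpace ℝ H] (P : ℝ → H →L[ℝ] H)
    (α t : ℝ) (f : H) : H :=
  ∫ s in Ioi (0 : ℝ), besselIntegrand P α t f s

end

noncomputable section

/-! Let `R = ∫_0^∞ e^{-αs} P_s ds`. By the semigroup law the weights `sᵏ/k! · e^{-αs}` average `P`
to `R^(k+1)`, and `J₀(2√(ts)) = ∑ (-t)ᵏ/k! · sᵏ/k!`. Termwise integration therefore gives `𝒥^α_t = ∑
(-t)ᵏ/k! · R^(k+1) = R exp(-tR)` (`moment_eq_pow`, `besselTransform_eq`). This needs the `P_t` to be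
contractions of `L²`, which is extracted from symmetry and the sub-Markov property
(`norm_apply_le`).

As `R` is self-adjoint and non-negative, so is every `Rⁿ exp(-tR)`. Its quadratic form at `f` has as
`t`-derivative minus that of `R^(n+1) exp(-tR)`; monotonicity, convexity and decay follow from the
signs of these derivatives.

For the spectral formula, `R` is the two-sided inverse of `α - A`. If `-A = ∫ l dE_l` and `f = (α -
A)h`, then `d(E_l f, f) = (l + α)² d(E_l h, h)` (`measure_apply`), hence `(Rf, f) = ∫ (l + α)⁻¹
d(E_l f, f)`. Induction extends this to powers of `R` (`inner_inverse_pow`), summation to `R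
exp(-tR)`, and polarisation to pairs `f, g`. -/

/-- A strongly continuous semigroup of symmetric contractions of a real Hilbert space (only the
values at times `t ≥ 0` matter). -/
structure IsSymmetricContractionSemigroup {H : Type*} [NormedAddCommGroup H]
    [InnerProductSpace ℝ H] (P : ℝ → H →L[ℝ] H) : Prop where
  zero : P 0 = 1
  add : ∀ s t : ℝ, 0 ≤ s → 0 ≤ t → P (s + t) = P s * P t
  strong_continuous : ∀ f : H, Tendsto (fun t : ℝ => P t f) (𝓝[>] 0) (𝓝 f)
  symmetric : ∀ t : ℝ, 0 ≤ t → ∀ f g : H, inner ℝ (P t f) g = inner ℝ f (P t g)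
  norm_le : ∀ t : ℝ, 0 ≤ t → ∀ f : H, ‖P t f‖ ≤ ‖f‖

/-! ### Contractivity of sub-Markovian semigroups on `L²`. -/

/-- If `aₖ² ≤ aₖ₊₁ M` and the sequence `a` is bounded, then `a₀ ≤ M`. -/
theorem le_of_sq_le_succ_mul_of_bounded {a : ℕ → ℝ} {M C : ℝ} (hM : 0 < M)
    (h : ∀ k, a k ^ 2 ≤ a (k + 1) * M) (hC : ∀ k, a k ≤ C) : a 0 ≤ M := by
  by_contra! hlt
  obtain ⟨q, hq⟩ : ∃ q, q = a 0 / M := ⟨_, rfl⟩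
  have hq1 : 1 < q := by rw [hq, lt_div_iff₀ hM]; linarith
  -- The true growth is doubly exponential; a geometric lower bound already contradicts boundedness
  -- and is easier to carry through the induction.
  have hb : ∀ k, M * q ^ (k + 1) ≤ a k := by
    intro k
    induction k with
    | zero => rw [hq]; simp; field_simp; exact le_rfl
    | succ k ih =>
      have hqk : q ≤ q ^ (k + 1) := le_self_pow₀ hq1.le (by omega)
      have h0 : 0 < q ^ (k + 1) := by positivity
      have h1 : (M * q ^ (k + 1)) ^ 2 ≤ a (k + 1) * M :=
        (pow_le_pow_left₀ (by positivity) ih 2).trans (h k)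
      have h2 : M * q ^ (k + 1 + 1) * M ≤ (M * q ^ (k + 1)) ^ 2 := by
        have : M * q ^ (k + 1 + 1) * M = M ^ 2 * (q ^ (k + 1) * q) := by ring
        rw [this, mul_pow, sq (q ^ (k + 1))]
        gcongr
      exact le_of_mul_le_mul_right (h2.trans h1) hM
  obtain ⟨n, hn⟩ := pow_unbounded_of_one_lt (C / M) hq1
  have h3 := (hb n).trans (hC n)
  rw [div_lt_iff₀ hM] at hn
  have : q ^ n ≤ q ^ (n + 1) := pow_le_pow_right₀ hq1.le (by omega)
  nlinarith

namespace IsSymmetricSubMarkovSemigroup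

variable {X : Type*} [MeasurableSpace X] {m : Measure X} {P : ℝ → L2 m →L[ℝ] L2 m}

theorem apply_mem_Icc (hP : IsSymmetricSubMarkovSemigroup m P) {t c : ℝ} (ht : 0 ≤ t)
    (hc : 0 < c) {f : L2 m} (hf : ∀ᵐ x ∂m, 0 ≤ f x ∧ f x ≤ c) :
    ∀ᵐ x ∂m, 0 ≤ P t f x ∧ P t f x ≤ c := by
  have h1 : ∀ᵐ x ∂m, 0 ≤ (c⁻¹ • f : L2 m) x ∧ (c⁻¹ • f : L2 m) x ≤ 1 := by
    filter_upwards [hf, Lp.coeFn_smul c⁻¹ f] with x hx hs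
    rw [hs, Pi.smul_apply, smul_eq_mul]
    refine ⟨mul_nonneg (inv_nonneg.2 hc.le) hx.1, ?_⟩
    rw [inv_mul_le_iff₀ hc, mul_one]
    exact hx.2
  have h2 := hP.sub_markov t ht _ h1
  rw [map_smul] at h2
  filter_upwards [h2, Lp.coeFn_smul c⁻¹ (P t f)] with x hx hs
  rw [hs, Pi.smul_apply, smul_eq_mul, inv_mul_le_iff₀ hc, mul_one] at hx
  exact ⟨nonneg_of_mul_nonneg_right hx.1 (inv_pos.2 hc), hx.2⟩

/-- The images of the positive and negative parts both take values in `[0, c]`, so their difference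
stays in `[-c, c]`, with no factor 2 lost. -/
theorem abs_apply_le (hP : IsSymmetricSubMarkovSemigroup m P) {t c : ℝ} (ht : 0 ≤ t)
    (hc : 0 < c) {f : L2 m} (hf : ∀ᵐ x ∂m, |f x| ≤ c) : ∀ᵐ x ∂m, |P t f x| ≤ c := by
  have hdec : f = Lp.posPart f - Lp.negPart f := by
    refine Lp.ext ?_
    filter_upwards [Lp.coeFn_sub (Lp.posPart f) (Lp.negPart f), Lp.coeFn_posPart f,
      Lp.coeFn_negPart_eq_max f] with x h1 h2 h3
    rw [h1, Pi.sub_apply, h2, h3]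
    exact (max_zero_sub_max_neg_zero_eq_self (f x)).symm
  have hpos := hP.apply_mem_Icc ht hc (f := Lp.posPart f) (by
    filter_upwards [hf, Lp.coeFn_posPart f] with x hx h1
    rw [h1]
    exact ⟨le_max_right _ _, max_le (abs_le.1 hx).2 hc.le⟩)
  have hneg := hP.apply_mem_Icc ht hc (f := Lp.negPart f) (by
    filter_upwards [hf, Lp.coeFn_negPart_eq_max f] with x hx h1
    rw [h1]
    exact ⟨le_max_right _ _, max_le (by linarith [(abs_le.1 hx).1]) hc.le⟩)
  have hPf : P t f = P t (Lp.posPart f) - P t (Lp.negPart f) := by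
    rw [← map_sub, ← hdec]
  rw [hPf]
  filter_upwards [hpos, hneg, Lp.coeFn_sub (P t (Lp.posPart f)) (P t (Lp.negPart f))]
    with x h1 h2 h3
  rw [h3, Pi.sub_apply, abs_le]
  constructor <;> linarith [h1.1, h1.2, h2.1, h2.2]

theorem norm_sq_eq (hP : IsSymmetricSubMarkovSemigroup m P) {t : ℝ} (ht : 0 ≤ t) (f : L2 m) :
    ‖P t f‖ ^ 2 = inner ℝ (P (t + t) f) f := by
  rw [hP.add t t ht ht, mul_apply_eq_comp, hP.symmetric t ht,
    real_inner_self_eq_norm_sq]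

/-- By symmetry `‖P_τ f‖² = (P_{2τ} f, f)`. This is at most `‖P_{2τ} f‖ ‖f‖`, and also at most `c ∫
|f|`, uniformly in `τ`. Along the times `2ᵏ t`, a norm exceeding `‖f‖` would grow without bound. -/
theorem norm_apply_le_of_bounded (hP : IsSymmetricSubMarkovSemigroup m P) {t c : ℝ} (ht : 0 ≤ t)
    (hc : 0 < c) {f : L2 m} (hf : ∀ᵐ x ∂m, |f x| ≤ c) (hint : Integrable f m) :
    ‖P t f‖ ≤ ‖f‖ := by
  rcases eq_or_ne f 0 with rfl | hf0
  · simp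
  have hbound : ∀ τ : ℝ, 0 ≤ τ → ‖P τ f‖ ^ 2 ≤ c * ∫ x, |f x| ∂m := by
    intro τ hτ
    rw [hP.norm_sq_eq hτ, L2.inner_def, ← integral_const_mul]
    refine integral_mono_ae (L2.integrable_inner _ _) (hint.abs.const_mul c) ?_
    filter_upwards [hP.abs_apply_le (add_nonneg hτ hτ) hc hf] with x hx
    refine (le_abs_self _).trans ?_
    simp only [RCLike.inner_apply, conj_trivial, abs_mul]
    rw [mul_comm]
    gcongr
  have h0 : ∀ k : ℕ, 0 ≤ 2 ^ k * t := fun k => by positivity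
  have := le_of_sq_le_succ_mul_of_bounded (a := fun k : ℕ => ‖P (2 ^ k * t) f‖)
    (C := √(c * ∫ x, |f x| ∂m)) (norm_pos_iff.2 hf0) (fun k => ?_)
    (fun k => Real.le_sqrt_of_sq_le (hbound _ (h0 k)))
  · simpa using this
  · rw [hP.norm_sq_eq (h0 k), show (2 : ℝ) ^ (k + 1) * t = 2 ^ k * t + 2 ^ k * t by ring]
    exact real_inner_le_norm _ _

theorem norm_apply_le (hP : IsSymmetricSubMarkovSemigroup m P) {t : ℝ} (ht : 0 ≤ t) (f : L2 m) :
    ‖P t f‖ ≤ ‖f‖ := by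
  refine (Lp.simpleFunc.denseRange (E := ℝ) (μ := m) (p := 2) (by simp)).induction_on f
    (isClosed_le (by fun_prop) (by fun_prop)) fun g => ?_
  have hae := Lp.simpleFunc.toSimpleFunc_eq_toFun g
  obtain ⟨C, hC⟩ := (Lp.simpleFunc.toSimpleFunc g).exists_forall_norm_le
  -- The maximum with 1 only makes the bound strictly positive.
  refine hP.norm_apply_le_of_bounded ht (c := max C 1) (by positivity) ?_ ?_
  · filter_upwards [hae] with x hx
    rw [← hx]
    exact (hC x).trans (le_max_left _ _)
  · exact ((SimpleFunc.memLp_iff_integrable (by simp) (by simp)).1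
      (Lp.simpleFunc.memLp g)).congr hae

theorem isSymmetricContractionSemigroup (hP : IsSymmetricSubMarkovSemigroup m P) :
    IsSymmetricContractionSemigroup P :=
  ⟨hP.zero, hP.add, hP.strong_continuous, hP.symmetric, fun _ ht f => hP.norm_apply_le ht f⟩

end IsSymmetricSubMarkovSemigroup

/-! ### Termwise integration, Gamma weights and the Bessel series. -/

/-- A series of integrable functions with summable `L¹` norms may be integrated term by term, and
its pointwise sum is integrable. -/
theorem integrable_and_hasSum_integral {Y G : Type*} [MeasurableSpace Y] {μ : Measure Y}
    [NormedAddCommGroup G] [NormedSpace ℝ G] {F : ℕ → Y → G} {g : Y → G}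
    (hF : ∀ k, Integrable (F k) μ) (hsum : Summable fun k => ∫ y, ‖F k y‖ ∂μ)
    (hg : ∀ᵐ y ∂μ, HasSum (fun k => F k y) (g y)) :
    Integrable g μ ∧ HasSum (fun k => ∫ y, F k y ∂μ) (∫ y, g y ∂μ) := by
  have hgt : g =ᵐ[μ] fun y => ∑' k, F k y := hg.mono fun y hy => hy.tsum_eq.symm
  refine ⟨⟨?_, ?_⟩, ?_⟩
  · refine aestronglyMeasurable_of_tendsto_ae atTop
      (f := fun (n : ℕ) y => ∑ k ∈ Finset.range n, F k y) (fun n => ?_) ?_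
    · exact (integrable_finsetSum _ fun k _ => hF k).aestronglyMeasurable
    · exact hg.mono fun y hy => hy.tendsto_sum_nat
  · have hle : ∫⁻ y, ‖g y‖ₑ ∂μ ≤ ∑' k, ENNReal.ofReal (∫ y, ‖F k y‖ ∂μ) := by
      calc ∫⁻ y, ‖g y‖ₑ ∂μ ≤ ∫⁻ y, ∑' k, ‖F k y‖ₑ ∂μ := by
            refine lintegral_mono_ae (hgt.mono fun y hy => ?_)
            rw [hy]
            exact enorm_tsum_le_tsum_enorm
        _ = ∑' k, ∫⁻ y, ‖F k y‖ₑ ∂μ := lintegral_tsum fun k => (hF k).aestronglyMeasurable.enorm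
        _ = ∑' k, ENNReal.ofReal (∫ y, ‖F k y‖ ∂μ) := by
            simp_rw [ofReal_integral_norm_eq_lintegral_enorm (hF _)]
    exact hle.trans_lt hsum.tsum_ofReal_lt_top
  · rw [integral_congr_ae hgt]
    exact hasSum_integral_of_summable_integral_norm hF hsum

/-- The function `s ↦ sᵏ / k! · e^{-α s}`. -/
def momentWeight (α : ℝ) (k : ℕ) (s : ℝ) : ℝ := s ^ k / (Nat.factorial k : ℝ) * Real.exp (-α * s)

theorem momentWeight_nonneg (α : ℝ) (k : ℕ) {s : ℝ} (hs : 0 ≤ s) : 0 ≤ momentWeight α k s := by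
  unfold momentWeight
  positivity

theorem integrableOn_momentWeight {α : ℝ} (hα : 0 < α) (k : ℕ) :
    IntegrableOn (momentWeight α k) (Ioi 0) := by
  have h := (integrableOn_rpow_mul_exp_neg_mul_rpow (p := 1) (s := k) (b := α)
    (by have : (0 : ℝ) ≤ k := k.cast_nonneg
        linarith) one_pos hα).div_const (Nat.factorial k : ℝ)
  refine h.congr (Eventually.of_forall fun s => ?_)
  simp only [momentWeight, Real.rpow_natCast, Real.rpow_one]
  ring

theorem integral_momentWeight {α : ℝ} (hα : 0 < α) (k : ℕ) :
    ∫ s in Ioi (0 : ℝ), momentWeight α k s = (1 / α) ^ (k + 1) := by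
  have h := Real.integral_rpow_mul_exp_neg_mul_Ioi (a := (k : ℝ) + 1) (by positivity) hα
  rw [Real.Gamma_nat_eq_factorial] at h
  have h2 : ∀ s, momentWeight α k s
      = (s ^ ((k : ℝ) + 1 - 1) * Real.exp (-(α * s))) / (Nat.factorial k : ℝ) := by
    intro s
    simp only [momentWeight, add_sub_cancel_right, Real.rpow_natCast, neg_mul]
    ring
  simp_rw [h2]
  rw [integral_div, h, mul_div_cancel_right₀ _ (by positivity)]
  exact_mod_cast Real.rpow_natCast (1 / α) (k + 1)

theorem momentWeight_zero_mul (α : ℝ) (k : ℕ) (s x : ℝ) :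
    momentWeight α 0 s * momentWeight α k (x - s)
      = (x - s) ^ k / (Nat.factorial k : ℝ) * Real.exp (-α * x) := by
  simp only [momentWeight, pow_zero, Nat.factorial_zero, Nat.cast_one, div_one, one_mul]
  rw [show -α * x = -α * s + -α * (x - s) by ring, Real.exp_add]
  ring

/-- The two factorials are split on purpose: one belongs to the exponential series in `-t`, the
other to the weight in `s`. -/
theorem hasSum_besselJ0 {t s : ℝ} (ht : 0 ≤ t) (hs : 0 ≤ s) :
    HasSum (fun k : ℕ => (-t) ^ k / (Nat.factorial k : ℝ) * (s ^ k / (Nat.factorial k : ℝ)))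
      (besselJ0 (2 * √(t * s))) := by
  have hterm : ∀ k : ℕ, (-1 : ℝ) ^ k / (Nat.factorial k : ℝ) ^ 2 * (2 * √(t * s) / 2) ^ (2 * k)
      = (-t) ^ k / (Nat.factorial k : ℝ) * (s ^ k / (Nat.factorial k : ℝ)) := by
    intro k
    rw [mul_div_cancel_left₀ _ (two_ne_zero), pow_mul, Real.sq_sqrt (by positivity), mul_pow,
      neg_pow t]
    ring
  rw [besselJ0]
  simp_rw [hterm]
  refine Summable.hasSum (Summable.of_norm_bounded (Real.summable_pow_div_factorial (t * s)) ?_)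
  intro k
  rw [norm_mul, norm_div, norm_div, norm_pow, norm_pow, norm_neg, Real.norm_of_nonneg ht,
    Real.norm_of_nonneg hs, Real.norm_of_nonneg (by positivity), mul_pow, div_mul_div_comm]
  refine div_le_div_of_nonneg_left (by positivity) (by positivity) ?_
  exact le_mul_of_one_le_left (by positivity) (by exact_mod_cast Nat.factorial_pos k)

/-! ### Averages of the semigroup and the identity `𝒥^α_t = R exp(-tR)`. -/

namespace IsSymmetricContractionSemigroup

variable {H : Type*} [NormedAddCommGroup H] [InnerProductSpace ℝ H]
  {P : ℝ → H →L[ℝ] H}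

theorem norm_apply_sub_le (hP : IsSymmetricContractionSemigroup P) (f : H) {s u : ℝ} (hs : 0 ≤ s)
    (hsu : s ≤ u) : ‖P u f - P s f‖ ≤ ‖P (u - s) f - f‖ := by
  have h : P u f = P s (P (u - s) f) := by
    rw [← mul_apply_eq_comp, ← hP.add s (u - s) hs (sub_nonneg.2 hsu), add_sub_cancel]
  rw [h, ← map_sub]
  exact hP.norm_le s hs _

theorem tendsto_abs (hP : IsSymmetricContractionSemigroup P) (f : H) :
    Tendsto (fun r : ℝ => P |r| f) (𝓝 0) (𝓝 f) := by
  have h1 : Tendsto (fun r => P r f) (𝓝[≥] 0) (𝓝 f) := by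
    have hunion : (Ici (0 : ℝ)) = insert 0 (Ioi 0) := by
      rw [insert_eq, union_comm]
      exact (Ioi_union_left (a := (0 : ℝ))).symm
    rw [hunion, nhdsWithin_insert]
    refine Tendsto.sup ?_ (hP.strong_continuous f)
    rw [tendsto_pure_left]
    intro s hs
    rw [hP.zero]
    exact mem_of_mem_nhds hs
  refine h1.comp (tendsto_nhdsWithin_iff.2 ⟨?_, Eventually.of_forall fun r => abs_nonneg r⟩)
  simpa using (continuous_abs.tendsto (0 : ℝ))

/-- Contractivity gives `‖P_u f - P_s f‖ ≤ ‖P_{|u-s|} f - f‖` on both sides of `s`, so right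
continuity at 0 suffices. -/
theorem continuousOn (hP : IsSymmetricContractionSemigroup P) (f : H) :
    ContinuousOn (fun s => P s f) (Ici 0) := by
  intro s hs
  rw [ContinuousWithinAt, tendsto_iff_norm_sub_tendsto_zero]
  have h1 : Tendsto (fun u : ℝ => ‖P |u - s| f - f‖) (𝓝[Ici 0] s) (𝓝 0) := by
    have h2 : Tendsto (fun u : ℝ => u - s) (𝓝[Ici 0] s) (𝓝 0) :=
      (tendsto_sub_nhds_zero_iff.2 tendsto_id).mono_left nhdsWithin_le_nhds
    have h3 := ((hP.tendsto_abs f).comp h2).sub_const f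
    rw [sub_self] at h3
    simpa using h3.norm
  refine squeeze_zero' (Eventually.of_forall fun u => norm_nonneg _) ?_ h1
  filter_upwards [self_mem_nhdsWithin] with u hu
  rcases le_total s u with h | h
  · rw [abs_of_nonneg (sub_nonneg.2 h)]
    exact hP.norm_apply_sub_le f hs h
  · rw [abs_of_nonpos (sub_nonpos.2 h), neg_sub, norm_sub_rev]
    exact hP.norm_apply_sub_le f hu h

theorem integrableOn_smul (hP : IsSymmetricContractionSemigroup P) {w : ℝ → ℝ}
    (hw : IntegrableOn w (Ioi 0)) (f : H) : IntegrableOn (fun s => w s • P s f) (Ioi 0) := by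
  refine Integrable.mono' (hw.norm.mul_const ‖f‖) (hw.aestronglyMeasurable.smul
    (((hP.continuousOn f).mono Ioi_subset_Ici_self).aestronglyMeasurable measurableSet_Ioi)) ?_
  filter_upwards [ae_restrict_mem measurableSet_Ioi] with s hs
  rw [norm_smul]
  gcongr
  exact hP.norm_le s (le_of_lt hs) f

theorem inner_apply_nonneg (hP : IsSymmetricContractionSemigroup P) {s : ℝ} (hs : 0 ≤ s) (f : H) :
    0 ≤ inner ℝ (P s f) f := by
  have h : P s f = P (s / 2) (P (s / 2) f) := by
    rw [← mul_apply_eq_comp, ← hP.add _ _ (by positivity) (by positivity), add_halves]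
  rw [h, hP.symmetric _ (by positivity)]
  exact real_inner_self_nonneg

/-- The bounded operator `∫_0^∞ w(s) P_s ds`. -/
def average (hP : IsSymmetricContractionSemigroup P) {w : ℝ → ℝ} (hw : IntegrableOn w (Ioi 0)) :
    H →L[ℝ] H :=
  LinearMap.mkContinuous
    { toFun := fun f => ∫ s in Ioi (0 : ℝ), w s • P s f
      map_add' := fun f g => by
        simp_rw [map_add, smul_add]
        exact integral_add (hP.integrableOn_smul hw f) (hP.integrableOn_smul hw g)
      map_smul' := fun c f => by
        simp_rw [map_smul, smul_comm (w _) c, RingHom.id_apply]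
        exact integral_smul c _ }
    (∫ s in Ioi (0 : ℝ), ‖w s‖) fun f => by
      rw [← integral_mul_const]
      refine norm_integral_le_of_norm_le (hw.norm.mul_const ‖f‖) ?_
      filter_upwards [ae_restrict_mem measurableSet_Ioi] with s hs
      rw [norm_smul]
      gcongr
      exact hP.norm_le s (le_of_lt hs) f

theorem average_apply (hP : IsSymmetricContractionSemigroup P) {w : ℝ → ℝ}
    (hw : IntegrableOn w (Ioi 0)) (f : H) :
    hP.average hw f = ∫ s in Ioi (0 : ℝ), w s • P s f := rfl

/-- The operator `∫_0^∞ sᵏ / k! · e^{-α s} P_s ds`. -/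
def moment (hP : IsSymmetricContractionSemigroup P) {α : ℝ} (hα : 0 < α) (k : ℕ) : H →L[ℝ] H :=
  hP.average (integrableOn_momentWeight hα k)

/-- The resolvent `∫_0^∞ e^{-α s} P_s ds`. -/
def resolvent (hP : IsSymmetricContractionSemigroup P) {α : ℝ} (hα : 0 < α) : H →L[ℝ] H :=
  hP.moment hα 0

variable [CompleteSpace H]

theorem inner_average (hP : IsSymmetricContractionSemigroup P) {w : ℝ → ℝ}
    (hw : IntegrableOn w (Ioi 0)) (f g : H) :
    inner ℝ (hP.average hw f) g = ∫ s in Ioi (0 : ℝ), w s * inner ℝ (P s f) g := by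
  rw [real_inner_comm, average_apply, ← integral_inner (hP.integrableOn_smul hw f) g]
  refine integral_congr_ae (Eventually.of_forall fun s => ?_)
  simp only [real_inner_smul_right]
  rw [real_inner_comm]

theorem average_isSymmetric (hP : IsSymmetricContractionSemigroup P) {w : ℝ → ℝ}
    (hw : IntegrableOn w (Ioi 0)) (f g : H) :
    inner ℝ (hP.average hw f) g = inner ℝ f (hP.average hw g) := by
  rw [inner_average, real_inner_comm, inner_average]
  refine setIntegral_congr_fun measurableSet_Ioi fun s hs => ?_
  rw [hP.symmetric s (le_of_lt hs), real_inner_comm]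

theorem isSelfAdjoint_resolvent (hP : IsSymmetricContractionSemigroup P) {α : ℝ} (hα : 0 < α) :
    IsSelfAdjoint (hP.resolvent hα) :=
  ContinuousLinearMap.isSelfAdjoint_iff_isSymmetric.2 fun f g => hP.average_isSymmetric (integrableOn_momentWeight hα 0) f g

theorem inner_resolvent_nonneg (hP : IsSymmetricContractionSemigroup P) {α : ℝ} (hα : 0 < α)
    (f : H) : 0 ≤ inner ℝ (hP.resolvent hα f) f := by
  rw [resolvent, moment, inner_average]
  refine setIntegral_nonneg measurableSet_Ioi fun s hs => ?_
  exact mul_nonneg (momentWeight_nonneg α 0 (le_of_lt hs)) (hP.inner_apply_nonneg (le_of_lt hs) f)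

/-- A product of two averages is the average over the convolved weight, since `P_t P_{x-t} = P_x`.
Here `∫_0^x (x-t)ᵏ/k! dt = x^(k+1)/(k+1)!`. Testing against `g` and moving the resolvent onto it
reduces this to a convolution under a bilinear form. -/
theorem moment_succ (hP : IsSymmetricContractionSemigroup P) {α : ℝ} (hα : 0 < α) (k : ℕ) :
    hP.moment hα (k + 1) = hP.resolvent hα * hP.moment hα k := by
  ext f
  refine ext_inner_right ℝ fun g => ?_
  have hconv : ∫ x in Ioi (0 : ℝ), ∫ t in 0..x, inner ℝ (momentWeight α 0 t • P t g)
      (momentWeight α k (x - t) • P (x - t) f)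
      = inner ℝ (hP.resolvent hα g) (hP.moment hα k f) :=
    integral_posConvolution (μ := volume) (ν := volume)
      (hP.integrableOn_smul (integrableOn_momentWeight hα 0) g)
      (hP.integrableOn_smul (integrableOn_momentWeight hα k) f) (innerSL ℝ)
  have hsymm : inner ℝ (hP.resolvent hα (hP.moment hα k f)) g
      = inner ℝ (hP.resolvent hα g) (hP.moment hα k f) := by
    rw [real_inner_comm]
    exact (hP.average_isSymmetric (integrableOn_momentWeight hα 0) g _).symm
  rw [mul_apply_eq_comp, hsymm, ← hconv, moment, inner_average]
  refine setIntegral_congr_fun measurableSet_Ioi fun x hx => ?_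
  have hx0 : (0 : ℝ) ≤ x := le_of_lt hx
  have hinner : EqOn (fun t => (inner ℝ (momentWeight α 0 t • P t g)
      (momentWeight α k (x - t) • P (x - t) f) : ℝ))
      (fun t => (x - t) ^ k * (Real.exp (-α * x) / (Nat.factorial k : ℝ) * inner ℝ (P x f) g))
      (uIcc 0 x) := by
    intro t ht
    rw [uIcc_of_le hx0] at ht
    have h1 : P x f = P t (P (x - t) f) := by
      rw [← mul_apply_eq_comp, ← hP.add t (x - t) ht.1 (sub_nonneg.2 ht.2), add_sub_cancel]
    simp only [real_inner_smul_left, real_inner_smul_right]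
    rw [← mul_assoc, mul_comm (momentWeight α k (x - t)), momentWeight_zero_mul, h1, hP.symmetric t ht.1 _ g, real_inner_comm]
    ring
  rw [intervalIntegral.integral_congr hinner, intervalIntegral.integral_mul_const,
    intervalIntegral.integral_comp_sub_left (fun t => t ^ k) x, sub_self, sub_zero, integral_pow]
  simp only [momentWeight, Nat.factorial_succ, Nat.cast_mul, Nat.cast_succ]
  field_simp
  simp [mul_comm]

theorem moment_eq_pow (hP : IsSymmetricContractionSemigroup P) {α : ℝ} (hα : 0 < α) (k : ℕ) :
    hP.moment hα k = hP.resolvent hα ^ (k + 1) := by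
  induction k with
  | zero => rw [zero_add, pow_one, resolvent]
  | succ k ih => rw [hP.moment_succ, ih, ← pow_succ']

/-- The `k`-th term has `L¹` norm at most `tᵏ/k! · α^(-k-1) ‖f‖`, a summable bound that yields
integrability as well as the interchange. -/
theorem integrableOn_besselIntegrand_and_hasSum (hP : IsSymmetricContractionSemigroup P) {α t : ℝ}
    (hα : 0 < α) (ht : 0 ≤ t) (f : H) :
    IntegrableOn (besselIntegrand P α t f) (Ioi 0) ∧
      HasSum (fun k : ℕ => ((-t) ^ k / (Nat.factorial k : ℝ)) • (hP.resolvent hα ^ (k + 1)) f)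
        (besselTransform P α t f) := by
  have hint : ∀ k, IntegrableOn (fun s => ((-t) ^ k / (Nat.factorial k : ℝ)) •
      (momentWeight α k s • P s f)) (Ioi 0) := fun k =>
    (hP.integrableOn_smul (integrableOn_momentWeight hα k) f).smul _
  have hval : ∀ k, ∫ s in Ioi (0 : ℝ), ((-t) ^ k / (Nat.factorial k : ℝ)) •
      (momentWeight α k s • P s f)
      = ((-t) ^ k / (Nat.factorial k : ℝ)) • (hP.resolvent hα ^ (k + 1)) f := by
    intro k
    rw [integral_smul, ← moment_eq_pow, moment, average_apply]
  simp_rw [← hval]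
  refine integrable_and_hasSum_integral hint ?_ ?_
  · refine Summable.of_nonneg_of_le (fun k => integral_nonneg fun s => norm_nonneg _) (fun k => ?_)
      ((Real.summable_pow_div_factorial (t * (1 / α))).mul_right ((1 / α) * ‖f‖))
    have hle : ∫ s in Ioi (0 : ℝ), ‖((-t) ^ k / (Nat.factorial k : ℝ)) •
        (momentWeight α k s • P s f)‖
        ≤ ∫ s in Ioi (0 : ℝ), t ^ k / (Nat.factorial k : ℝ) * (momentWeight α k s * ‖f‖) := by
      refine setIntegral_mono_on (hint k).norm
        (((integrableOn_momentWeight hα k).mul_const _).const_mul _) measurableSet_Ioi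
        fun s hs => ?_
      rw [norm_smul, norm_smul, norm_div, norm_pow, norm_neg, Real.norm_of_nonneg ht,
        Real.norm_of_nonneg (momentWeight_nonneg α k (le_of_lt hs)),
        Real.norm_of_nonneg (by positivity)]
      have := momentWeight_nonneg α k (le_of_lt hs)
      gcongr
      exact hP.norm_le s (le_of_lt hs) f
    refine hle.trans_eq ?_
    rw [integral_const_mul, integral_mul_const, integral_momentWeight hα]
    ring
  · filter_upwards [ae_restrict_mem measurableSet_Ioi] with s hs
    have h := ((hasSum_besselJ0 ht (le_of_lt hs)).mul_right (Real.exp (-α * s))).smul_const (P s f)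
    refine h.congr_fun fun k => ?_
    rw [smul_smul, momentWeight, mul_assoc]

theorem besselTransform_eq (hP : IsSymmetricContractionSemigroup P) {α t : ℝ}
    (hα : 0 < α) (ht : 0 ≤ t) (f : H) :
    besselTransform P α t f
      = (hP.resolvent hα * NormedSpace.exp ((-t) • hP.resolvent hα)) f := by
  refine (hP.integrableOn_besselIntegrand_and_hasSum hα ht f).2.unique ?_
  have h := (NormedSpace.exp_series_hasSum_exp' (𝕂 := ℝ) ((-t) • hP.resolvent hα)).mul_left
    (hP.resolvent hα)
  have h2 := h.mapL (ContinuousLinearMap.apply ℝ H f)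
  refine h2.congr_fun fun k => ?_
  simp only [ContinuousLinearMap.apply_apply]
  rw [smul_pow, smul_smul, mul_smul_comm, ← pow_succ', smul_apply]
  congr 1
  ring

end IsSymmetricContractionSemigroup

/-! ### Quadratic forms of `Sⁿ exp(-tS)` for non-negative self-adjoint `S`. -/

section SelfAdjoint

variable {H : Type*} [NormedAddCommGroup H] [InnerProductSpace ℝ H] [CompleteSpace H]
  {S : H →L[ℝ] H}

/-- From `S^(n+2) = S Sⁿ S`, the form at `f` is that of `Sⁿ` at `S f`; no square root is needed. -/
theorem inner_pow_apply_nonneg (hS : IsSelfAdjoint S) (hpos : ∀ f, 0 ≤ inner ℝ (S f) f) (n : ℕ)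
    (f : H) : 0 ≤ inner ℝ ((S ^ n) f) f := by
  induction n using Nat.strong_induction_on generalizing f with
  | _ n ih =>
    match n, ih with
    | 0, _ => simp
    | 1, _ => simpa using hpos f
    | n + 2, ih =>
      have h : (S ^ (n + 2)) f = S ((S ^ n) (S f)) := by
        rw [pow_succ, pow_succ']
        rfl
      have hsymm := ContinuousLinearMap.isSelfAdjoint_iff_isSymmetric.1 hS ((S ^ n) (S f)) f
      simp only [ContinuousLinearMap.coe_coe] at hsymm
      rw [h, hsymm]
      exact ih n (by omega) (S f)

/-- With `G = exp(-(t/2)S)`, self-adjoint and commuting with `S`, the operator is `G Sⁿ G`. -/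
theorem inner_pow_mul_exp_apply_nonneg (hS : IsSelfAdjoint S) (hpos : ∀ f, 0 ≤ inner ℝ (S f) f)
    (n : ℕ) (t : ℝ) (f : H) : 0 ≤ inner ℝ ((S ^ n * NormedSpace.exp ((-t) • S)) f) f := by
  have hG : IsSelfAdjoint (NormedSpace.exp ((-(t / 2)) • S)) :=
    ((IsSelfAdjoint.all (-(t / 2))).smul hS).exp
  have hcomm : Commute (S ^ n) (NormedSpace.exp ((-(t / 2)) • S)) :=
    (((Commute.refl S).smul_right _).exp_right).pow_left n
  have hmul : NormedSpace.exp ((-t) • S)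
      = NormedSpace.exp ((-(t / 2)) • S) * NormedSpace.exp ((-(t / 2)) • S) := by
    let _ : NormedAlgebra ℚ (H →L[ℝ] H) := NormedAlgebra.restrictScalars ℚ ℝ _
    rw [← NormedSpace.exp_add_of_commute (Commute.refl _), ← add_smul]
    congr 2
    ring
  have hsymm := ContinuousLinearMap.isSelfAdjoint_iff_isSymmetric.1 hG
    ((S ^ n) (NormedSpace.exp ((-(t / 2)) • S) f)) f
  simp only [ContinuousLinearMap.coe_coe] at hsymm
  rw [hmul, ← mul_assoc, hcomm.eq, mul_apply_eq_comp, mul_apply_eq_comp, hsymm]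
  exact inner_pow_apply_nonneg hS hpos n _

variable (S) in
theorem hasDerivAt_inner_pow_mul_exp (n : ℕ) (f : H) (t : ℝ) :
    HasDerivAt (fun t : ℝ => (inner ℝ ((S ^ n * NormedSpace.exp ((-t) • S)) f) f : ℝ))
      (-inner ℝ ((S ^ (n + 1) * NormedSpace.exp ((-t) • S)) f) f) t := by
  have h1 : HasDerivAt (fun t : ℝ => NormedSpace.exp ((-t) • S))
      (-(S * NormedSpace.exp ((-t) • S))) t := by
    have h := (hasDerivAt_exp_smul_const' (𝕂 := ℝ) S (-t)).scomp t (hasDerivAt_neg t)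
    simpa [Function.comp_def] using! h
  have h2 := (h1.const_mul (S ^ n)).clm_apply (hasDerivAt_const t f)
  have h3 := h2.inner ℝ (hasDerivAt_const t f)
  convert! h3 using 1
  simp [pow_succ, mul_assoc, inner_neg_left]

theorem antitone_inner_pow_mul_exp (hS : IsSelfAdjoint S)
    (hpos : ∀ f, 0 ≤ inner ℝ (S f) f) (n : ℕ) (f : H) :
    Antitone fun t : ℝ => (inner ℝ ((S ^ n * NormedSpace.exp ((-t) • S)) f) f : ℝ) :=
  antitone_of_hasDerivAt_nonpos (hasDerivAt_inner_pow_mul_exp S n f) fun t =>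
    neg_nonpos.2 (inner_pow_mul_exp_apply_nonneg hS hpos (n + 1) t f)

theorem convexOn_inner_pow_mul_exp (hS : IsSelfAdjoint S)
    (hpos : ∀ f, 0 ≤ inner ℝ (S f) f) (n : ℕ) (f : H) :
    ConvexOn ℝ univ fun t : ℝ => (inner ℝ ((S ^ n * NormedSpace.exp ((-t) • S)) f) f : ℝ) := by
  refine Monotone.convexOn_univ_of_deriv
    (fun t => (hasDerivAt_inner_pow_mul_exp S n f t).differentiableAt) ?_
  rw [funext fun t => (hasDerivAt_inner_pow_mul_exp S n f t).deriv]
  exact (antitone_inner_pow_mul_exp hS hpos (n + 1) f).neg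

/-- Write `φ_n` for the form with exponent `n`. As `φ_{n+1} = -φ_n'` is non-increasing, the mean
value theorem on `[0, t]` gives `t φ_{n+1}(t) ≤ φ_n(0) - φ_n(t) ≤ φ_n(0)`, a decay of order `1/t`.
-/
theorem tendsto_inner_pow_mul_exp (hS : IsSelfAdjoint S)
    (hpos : ∀ f, 0 ≤ inner ℝ (S f) f) (n : ℕ) (f : H) :
    Tendsto (fun t : ℝ => (inner ℝ ((S ^ (n + 1) * NormedSpace.exp ((-t) • S)) f) f : ℝ))
      atTop (𝓝 0) := by
  obtain ⟨C, hC⟩ : ∃ C : ℝ, C = inner ℝ ((S ^ n * NormedSpace.exp ((-(0 : ℝ)) • S)) f) f :=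
    ⟨_, rfl⟩
  refine squeeze_zero' (g := fun t => C / t)
    (Eventually.of_forall fun t => inner_pow_mul_exp_apply_nonneg hS hpos (n + 1) t f) ?_
    (tendsto_const_nhds.div_atTop tendsto_id)
  filter_upwards [eventually_gt_atTop 0] with t ht
  obtain ⟨c, hc, hslope⟩ := exists_hasDerivAt_eq_slope _ _ ht
    (fun x _ => (hasDerivAt_inner_pow_mul_exp S n f x).continuousAt.continuousWithinAt)
    (fun x _ => hasDerivAt_inner_pow_mul_exp S n f x)
  have h1 := antitone_inner_pow_mul_exp hS hpos (n + 1) f hc.2.le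
  have h2 := inner_pow_mul_exp_apply_nonneg hS hpos n t f
  simp only at h1
  rw [← hC, sub_zero, eq_div_iff ht.ne'] at hslope
  rw [le_div_iff₀ ht]
  nlinarith

end SelfAdjoint

/-! ### The generator and its resolvent. -/

section Generator

variable {H : Type*} [NormedAddCommGroup H] [NormedSpace ℝ H] {P : ℝ → H →L[ℝ] H}

theorem tendsto_generator (f : (generator P).domain) :
    Tendsto (fun t : ℝ => t⁻¹ • (P t (f : H) - f)) (𝓝[>] 0) (𝓝 (generator P f)) :=
  Classical.choose_spec f.2

theorem generator_eq_of_tendsto {f g : H}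
    (h : Tendsto (fun t : ℝ => t⁻¹ • (P t f - f)) (𝓝[>] 0) (𝓝 g)) :
    ∃ hf : f ∈ (generator P).domain, generator P ⟨f, hf⟩ = g :=
  ⟨⟨g, h⟩, tendsto_nhds_unique (tendsto_generator ⟨f, ⟨g, h⟩⟩) h⟩

end Generator

theorem setIntegral_Ioi_comp_add_right {G : Type*} [NormedAddCommGroup G] [NormedSpace ℝ G]
    (F : ℝ → G) (t : ℝ) : ∫ s in Ioi (0 : ℝ), F (s + t) = ∫ u in Ioi t, F u := by
  have h := (measurePreserving_add_right volume t).setIntegral_preimage_emb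
    (measurableEmbedding_addRight t) F (Ioi t)
  rw [← h]
  simp

namespace IsSymmetricContractionSemigroup

variable {H : Type*} [NormedAddCommGroup H] [InnerProductSpace ℝ H]
  {P : ℝ → H →L[ℝ] H}

theorem continuous_apply_abs (hP : IsSymmetricContractionSemigroup P) (f : H) :
    Continuous fun u : ℝ => P |u| f :=
  (hP.continuousOn f).comp_continuous continuous_abs fun u => abs_nonneg u

theorem generator_isSymmetric (hP : IsSymmetricContractionSemigroup P)
    (f g : (generator P).domain) :
    inner ℝ (generator P f) (g : H) = inner ℝ (f : H) (generator P g) := by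
  refine tendsto_nhds_unique ((tendsto_generator f).inner tendsto_const_nhds)
    ((tendsto_const_nhds.inner (tendsto_generator g)).congr' ?_)
  filter_upwards [self_mem_nhdsWithin] with t ht
  rw [real_inner_smul_left, real_inner_smul_right, inner_sub_left, inner_sub_right,
    hP.symmetric t (le_of_lt ht)]

variable [CompleteSpace H]

/-- The shift `u = s + t` turns `P_t R f` into `e^{αt} ∫_t^∞ e^{-αu} P_u f du`. Writing `|u|` makes
the integrand continuous on all of `ℝ`, so that it can be differentiated at `t = 0`. -/
theorem apply_resolvent_eq (hP : IsSymmetricContractionSemigroup P) {α t : ℝ} (hα : 0 < α)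
    (ht : 0 ≤ t) (f : H) :
    P t (hP.resolvent hα f) = Real.exp (α * t) •
      (hP.resolvent hα f - ∫ u in (0 : ℝ)..t, Real.exp (-α * u) • P |u| f) := by
  have hint := hP.integrableOn_smul (integrableOn_momentWeight hα 0) f
  have hint' : IntegrableOn (fun u => Real.exp (-α * u) • P |u| f) (Ioi 0) := by
    refine hint.congr_fun (fun u hu => ?_) measurableSet_Ioi
    simp [momentWeight, abs_of_pos (mem_Ioi.1 hu)]
  have hres : hP.resolvent hα f = ∫ u in Ioi (0 : ℝ), Real.exp (-α * u) • P |u| f := by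
    refine setIntegral_congr_fun measurableSet_Ioi fun u hu => ?_
    simp [momentWeight, abs_of_pos (mem_Ioi.1 hu)]
  have hshift : P t (hP.resolvent hα f)
      = ∫ s in Ioi (0 : ℝ), Real.exp (α * t) • (Real.exp (-α * (s + t)) • P |s + t| f) := by
    rw [resolvent, moment, average_apply, ← (P t).integral_comp_comm hint]
    refine setIntegral_congr_fun measurableSet_Ioi fun s hs => ?_
    have hs0 : (0 : ℝ) ≤ s := le_of_lt hs
    have hadd : P |s + t| f = P t (P s f) := by
      rw [abs_of_nonneg (add_nonneg hs0 ht), ← mul_apply_eq_comp, ← hP.add t s ht hs0, add_comm]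
    simp only [momentWeight, map_smul]
    rw [hadd, smul_smul, ← Real.exp_add, show α * t + -α * (s + t) = -α * s by ring]
    simp
  rw [hshift, integral_smul, setIntegral_Ioi_comp_add_right (fun u => Real.exp (-α * u) • P |u| f),
    hres, ← intervalIntegral.integral_Ioi_sub_Ioi hint' ht, sub_sub_cancel]

theorem tendsto_resolvent (hP : IsSymmetricContractionSemigroup P) {α : ℝ} (hα : 0 < α) (f : H) :
    Tendsto (fun t : ℝ => t⁻¹ • (P t (hP.resolvent hα f) - hP.resolvent hα f)) (𝓝[>] 0)
      (𝓝 (α • hP.resolvent hα f - f)) := by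
  have hcont : Continuous fun u : ℝ => Real.exp (-α * u) • P |u| f :=
    (by fun_prop : Continuous fun u : ℝ => Real.exp (-α * u)).smul (hP.continuous_apply_abs f)
  have h1 := (hcont.integral_hasStrictDerivAt 0 0).hasDerivAt
  have h2 : HasDerivAt (fun t : ℝ => Real.exp (α * t)) α 0 := by
    simpa using ((hasDerivAt_id (0 : ℝ)).const_mul α).exp
  have h3 := h2.smul (h1.const_sub (hP.resolvent hα f))
  have h4 := (hasDerivWithinAt_iff_tendsto_slope' (by simp)).1
    (h3.hasDerivWithinAt (s := Ioi 0))
  have hval : Real.exp (α * 0) • -(Real.exp (-α * 0) • P |0| f)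
      + α • (hP.resolvent hα f - ∫ u in (0 : ℝ)..0, Real.exp (-α * u) • P |u| f)
      = α • hP.resolvent hα f - f := by
    simp [hP.zero, sub_eq_neg_add]
  rw [hval] at h4
  refine h4.congr' ?_
  filter_upwards [self_mem_nhdsWithin] with t ht
  rw [hP.apply_resolvent_eq hα (le_of_lt ht), slope_def_module]
  simp

theorem generator_resolvent (hP : IsSymmetricContractionSemigroup P) {α : ℝ} (hα : 0 < α) (f : H) :
    ∃ hf : hP.resolvent hα f ∈ (generator P).domain,
      generator P ⟨hP.resolvent hα f, hf⟩ = α • hP.resolvent hα f - f :=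
  generator_eq_of_tendsto (hP.tendsto_resolvent hα f)

/-- The left inverse follows from the right inverse `(α - A)R = 1` by symmetry of `A` and `R`. -/
theorem resolvent_apply_sub_generator (hP : IsSymmetricContractionSemigroup P) {α : ℝ}
    (hα : 0 < α) (f : (generator P).domain) :
    hP.resolvent hα (α • (f : H) - generator P f) = f := by
  refine ext_inner_right ℝ fun g => ?_
  obtain ⟨hg, hgen⟩ := hP.generator_resolvent hα g
  have h := hP.generator_isSymmetric f ⟨_, hg⟩
  rw [hgen] at h
  have hsymm : inner ℝ (hP.resolvent hα (α • (f : H) - generator P f)) g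
      = inner ℝ (α • (f : H) - generator P f) (hP.resolvent hα g) :=
    hP.average_isSymmetric (integrableOn_momentWeight hα 0) _ g
  rw [hsymm, inner_sub_left, h, inner_sub_right, real_inner_smul_left, real_inner_smul_right]
  ring

end IsSymmetricContractionSemigroup

/-! ### Calculus of the measures `d(E_l f, f)` and `d(E_l f, g)`. -/

namespace SpectralFamily

variable {H : Type*} [NormedAddCommGroup H] [InnerProductSpace ℝ H] [CompleteSpace H]
  (E : SpectralFamily H)

theorem inner_proj_left {l : ℝ} (hl : 0 ≤ l) (f g : H) :
    inner ℝ (E.proj l f) g = inner ℝ f (E.proj l g) :=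
  ContinuousLinearMap.isSelfAdjoint_iff_isSymmetric.1 (E.isStarProjection l hl).isSelfAdjoint f g

theorem proj_proj_of_le {l u : ℝ} (hl : 0 ≤ l) (hlu : l ≤ u) (f : H) :
    E.proj l (E.proj u f) = E.proj l f :=
  congrArg (fun T => T f) (E.mul_eq l u hl hlu)

theorem proj_proj_of_ge {l u : ℝ} (hu : 0 ≤ u) (hul : u ≤ l) (f : H) :
    E.proj l (E.proj u f) = E.proj u f := by
  refine ext_inner_right ℝ fun g => ?_
  rw [E.inner_proj_left (hu.trans hul), E.inner_proj_left hu, E.proj_proj_of_le hu hul,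
    ← E.inner_proj_left hu]

theorem proj_comm {l u : ℝ} (hl : 0 ≤ l) (hu : 0 ≤ u) (f : H) :
    E.proj l (E.proj u f) = E.proj u (E.proj l f) := by
  rcases le_total l u with h | h
  · rw [E.proj_proj_of_le hl h, E.proj_proj_of_ge hl h]
  · rw [E.proj_proj_of_ge hu h, E.proj_proj_of_le hu h]

theorem inner_proj_self_nonneg {l : ℝ} (hl : 0 ≤ l) (f : H) : 0 ≤ inner ℝ (E.proj l f) f := by
  rw [E.inner_eq hl]
  positivity

theorem measure_Iic_eq_ite (f : H) (l : ℝ) :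
    E.measure f (Iic l) = ENNReal.ofReal (if 0 ≤ l then inner ℝ (E.proj l f) f else 0) := by
  have hbot : Tendsto (E.distribution f) atBot (𝓝 0) := by
    refine tendsto_const_nhds.congr' ?_
    filter_upwards [Iio_mem_atBot (0 : ℝ)] with u hu
    exact (if_neg (not_le.2 hu)).symm
  rw [SpectralFamily.measure, StieltjesFunction.measure_Iic _ hbot, sub_zero]
  rfl

theorem measure_Iic {l : ℝ} (hl : 0 ≤ l) (f : H) :
    E.measure f (Iic l) = ENNReal.ofReal (inner ℝ (E.proj l f) f) := by
  rw [measure_Iic_eq_ite, if_pos hl]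

theorem measure_Iio_zero (f : H) : E.measure f (Iio 0) = 0 := by
  have h : Iio (0 : ℝ) = ⋃ n : ℕ, Iic (-(1 / ((n : ℝ) + 1))) := by
    ext x
    simp only [mem_Iio, mem_iUnion, mem_Iic]
    refine ⟨fun hx => ?_, fun ⟨n, hn⟩ => hn.trans_lt (neg_neg_of_pos (by positivity))⟩
    obtain ⟨n, hn⟩ := exists_nat_one_div_lt (neg_pos.2 hx)
    exact ⟨n, by linarith⟩
  rw [h, measure_iUnion_null_iff]
  intro n
  have hn : (0 : ℝ) < 1 / ((n : ℝ) + 1) := by positivity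
  rw [measure_Iic_eq_ite, if_neg (by linarith), ENNReal.ofReal_zero]

theorem ae_nonneg (f : H) : ∀ᵐ l ∂E.measure f, 0 ≤ l := by
  rw [ae_iff]
  simpa only [not_le] using! E.measure_Iio_zero f

theorem measure_univ (f : H) : E.measure f univ = ENNReal.ofReal (‖f‖ ^ 2) := by
  have h1 : Tendsto (fun l => E.measure f (Iic l)) atTop (𝓝 (E.measure f univ)) :=
    tendsto_measure_Iic_atTop _
  have h2 : Tendsto (fun l => ENNReal.ofReal (inner ℝ (E.proj l f) f)) atTop
      (𝓝 (ENNReal.ofReal (inner ℝ f f))) :=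
    ENNReal.tendsto_ofReal ((E.tendsto_atTop f).inner tendsto_const_nhds)
  rw [← real_inner_self_eq_norm_sq]
  refine tendsto_nhds_unique h1 (h2.congr' ?_)
  filter_upwards [eventually_ge_atTop 0] with l hl
  rw [E.measure_Iic hl]

instance isFiniteMeasure_measure (f : H) : IsFiniteMeasure (E.measure f) :=
  ⟨by rw [E.measure_univ]; exact ENNReal.ofReal_lt_top⟩

theorem measureReal_Iic {l : ℝ} (hl : 0 ≤ l) (f : H) :
    (E.measure f).real (Iic l) = inner ℝ (E.proj l f) f := by
  rw [measureReal_def, E.measure_Iic hl, ENNReal.toReal_ofReal (E.inner_proj_self_nonneg hl f)]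

theorem measureReal_univ (f : H) : (E.measure f).real univ = ‖f‖ ^ 2 := by
  rw [measureReal_def, E.measure_univ, ENNReal.toReal_ofReal (by positivity)]

/-- Two finite measures carried by `[0, ∞)` with the same distribution function are equal. -/
theorem ext_of_Iic_of_nonneg {μ ν : Measure ℝ} [IsFiniteMeasure μ] [IsFiniteMeasure ν]
    (hμ : μ (Iio 0) = 0) (hν : ν (Iio 0) = 0) (h : ∀ l, 0 ≤ l → μ.real (Iic l) = ν.real (Iic l)) :
    μ = ν := by
  refine Measure.ext_of_Iic μ ν fun l => ?_
  rcases le_or_gt 0 l with hl | hl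
  · exact (measureReal_eq_measureReal_iff).1 (h l hl)
  · rw [measure_mono_null (Iic_subset_Iio.2 hl) hμ, measure_mono_null (Iic_subset_Iio.2 hl) hν]

/-- Because `(E_l E_u f, E_u f) = (E_{min(l,u)} f, f)`. -/
theorem measure_proj {u : ℝ} (hu : 0 ≤ u) (f : H) :
    E.measure (E.proj u f) = (E.measure f).restrict (Iic u) := by
  refine ext_of_Iic_of_nonneg (E.measure_Iio_zero _) ?_ fun l hl => ?_
  · exact le_antisymm ((Measure.restrict_le_self _).trans (E.measure_Iio_zero f).le) bot_le
  · rw [E.measureReal_Iic hl, measureReal_restrict_apply measurableSet_Iic, Iic_inter_Iic,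
      E.measureReal_Iic (le_inf hl hu)]
    rcases le_total l u with h | h
    · rw [E.proj_proj_of_le hl h, ← E.inner_proj_left hu, E.proj_proj_of_ge hl h, inf_eq_left.2 h]
    · rw [E.proj_proj_of_ge hu h, ← E.inner_proj_left hu, E.proj_proj_of_ge hu le_rfl,
        inf_eq_right.2 h]

/-- If `(E_l f, g) = (E_l f', g')` for all `l`, then `d(E_l f, g)` and `d(E_l f', g')` agree. -/
theorem weakIntegral_congr {f g f' g' : H}
    (h : ∀ l, 0 ≤ l → inner ℝ (E.proj l f) g = inner ℝ (E.proj l f') g') {φ : ℝ → ℝ}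
    (h1 : Integrable φ (E.measure (f + g))) (h2 : Integrable φ (E.measure (f - g)))
    (h3 : Integrable φ (E.measure (f' + g'))) (h4 : Integrable φ (E.measure (f' - g'))) :
    E.weakIntegral φ f g = E.weakIntegral φ f' g' := by
  -- Moving the subtracted measures across turns equality of signed measures into equality of finite
  -- positive ones.
  have hμ : E.measure (f + g) + E.measure (f' - g')
      = E.measure (f - g) + E.measure (f' + g') := by
    refine ext_of_Iic_of_nonneg ?_ ?_ fun l hl => ?_
    · simp [E.measure_Iio_zero]
    · simp [E.measure_Iio_zero]
    · have h5 : inner ℝ (E.proj l g) f = inner ℝ (E.proj l f) g := by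
        rw [E.inner_proj_left hl, real_inner_comm]
      have h6 : inner ℝ (E.proj l g') f' = inner ℝ (E.proj l f') g' := by
        rw [E.inner_proj_left hl, real_inner_comm]
      rw [measureReal_add_apply, measureReal_add_apply]
      simp only [E.measureReal_Iic hl, map_add, map_sub, inner_add_left, inner_add_right,
        inner_sub_left, inner_sub_right, h5, h6, h l hl]
      ring
  have hint := congrArg (fun μ => ∫ l, φ l ∂μ) hμ
  rw [integral_add_measure h1 h4, integral_add_measure h2 h3] at hint
  unfold weakIntegral
  linarith

theorem weakIntegral_self (φ : ℝ → ℝ) (f : H) :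
    E.weakIntegral φ f f = ∫ l, φ l ∂E.measure f := by
  have h0 : E.measure (f - f) = 0 := by
    rw [← Measure.measure_univ_eq_zero, E.measure_univ]
    simp
  have h4 : E.measure (f + f) = (4 : ℝ≥0∞) • E.measure f := by
    have : IsFiniteMeasure ((4 : ℝ≥0∞) • E.measure f) := Measure.smul_finite _ (by simp)
    refine ext_of_Iic_of_nonneg (E.measure_Iio_zero _) ?_ fun l hl => ?_
    · simp [E.measure_Iio_zero]
    · simp only [measureReal_ennreal_smul_apply, E.measureReal_Iic hl, map_add, inner_add_left,
        inner_add_right]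
      norm_num
      ring
  rw [weakIntegral, h0, h4, integral_smul_measure, integral_zero_measure]
  norm_num

/-- If `(E_l f, g) = ∫_{[0, l]} φ d(E_l f, f)` for all `l`, then `d(E_l f, g) = φ d(E_l f, f)`. -/
theorem weakIntegral_eq_integral_mul {f g : H} {φ ψ : ℝ → ℝ} (hφ : Integrable φ (E.measure f))
    (hφ0 : 0 ≤ᵐ[E.measure f] φ)
    (h : ∀ l, 0 ≤ l → inner ℝ (E.proj l f) g = ∫ x in Iic l, φ x ∂E.measure f)
    (h1 : Integrable ψ (E.measure (f + g))) (h2 : Integrable ψ (E.measure (f - g))) :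
    E.weakIntegral ψ f g = ∫ l, ψ l * φ l ∂E.measure f := by
  -- The 4 is the polarisation constant: `ν` is to be the excess of `E.measure (f + g)` over
  -- `E.measure (f - g)`.
  obtain ⟨ν, hν⟩ : ∃ ν, ν = (E.measure f).withDensity fun l => ENNReal.ofReal (4 * φ l) := ⟨_, rfl⟩
  have hφ4 := hφ.const_mul 4
  have hφ40 : 0 ≤ᵐ[E.measure f] fun l => 4 * φ l := hφ0.mono fun l hl => mul_nonneg (by simp) hl
  have hfin : IsFiniteMeasure ν := by
    rw [hν]
    exact isFiniteMeasure_withDensity_ofReal hφ4.2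
  have hμ : E.measure (f + g) = E.measure (f - g) + ν := by
    refine ext_of_Iic_of_nonneg (E.measure_Iio_zero _) ?_ fun l hl => ?_
    · rw [Measure.add_apply, E.measure_Iio_zero, zero_add, hν]
      exact withDensity_absolutelyContinuous _ _ (E.measure_Iio_zero f)
    · have h5 : inner ℝ (E.proj l g) f = inner ℝ (E.proj l f) g := by
        rw [E.inner_proj_left hl, real_inner_comm]
      have h6 : ν.real (Iic l) = 4 * ∫ x in Iic l, φ x ∂E.measure f := by
        rw [measureReal_def, hν, withDensity_apply _ measurableSet_Iic,
          ← integral_eq_lintegral_of_nonneg_ae (ae_restrict_of_ae hφ40)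
            hφ4.aestronglyMeasurable.restrict, integral_const_mul]
      rw [measureReal_add_apply, h6, ← h l hl]
      simp only [E.measureReal_Iic hl, map_add, map_sub, inner_add_left, inner_add_right,
        inner_sub_left, inner_sub_right, h5]
      ring
  have hψν : Integrable ψ ν := by
    rw [hμ] at h1
    exact h1.right_of_add_measure
  have hint : ∫ l, ψ l ∂ν = 4 * ∫ l, ψ l * φ l ∂E.measure f := by
    rw [hν, integral_withDensity_eq_integral_toReal_smul₀ hφ4.aemeasurable.ennreal_ofReal
      (Eventually.of_forall fun l => ENNReal.ofReal_lt_top), ← integral_const_mul]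
    refine integral_congr_ae (hφ40.mono fun l hl => ?_)
    simp only [smul_eq_mul]
    rw [ENNReal.toReal_ofReal hl]
    ring
  rw [weakIntegral, hμ, integral_add_measure h2 hψν, hint]
  ring

theorem weakIntegral_eq_inner {S : H →L[ℝ] H} (hS : IsSelfAdjoint S) {φ : ℝ → ℝ}
    (h : ∀ f, inner ℝ (S f) f = ∫ l, φ l ∂E.measure f) (f g : H) :
    inner ℝ (S f) g = E.weakIntegral φ f g := by
  have hsymm : inner ℝ (S g) f = inner ℝ (S f) g := by
    rw [real_inner_comm]
    exact (ContinuousLinearMap.isSelfAdjoint_iff_isSymmetric.1 hS f g).symm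
  rw [weakIntegral, ← h, ← h]
  simp only [map_add, map_sub, inner_add_left, inner_add_right, inner_sub_left, inner_sub_right,
    hsymm]
  ring

end SpectralFamily

/-! ### The operator `L = ∫ l dE_l` and functions of the inverse of `L + α`. -/

namespace SpectralFamily

variable {H : Type*} [NormedAddCommGroup H] [InnerProductSpace ℝ H] [CompleteSpace H]
  {E : SpectralFamily H} {L : H →ₗ.[ℝ] H}

theorem HasResolution.integrable {φ : ℝ → ℝ} (hL : E.HasResolution φ L) {f : H}
    (hf : f ∈ L.domain) : Integrable φ (E.measure f) :=
  ((hL.1 f).1 hf).integrable one_le_two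

theorem ae_proj_mem_Icc (E : SpectralFamily H) {u : ℝ} (hu : 0 ≤ u) (f : H) :
    ∀ᵐ l ∂E.measure (E.proj u f), l ∈ Icc 0 u := by
  have h := E.ae_nonneg (E.proj u f)
  rw [E.measure_proj hu] at h ⊢
  filter_upwards [h, ae_restrict_mem measurableSet_Iic] with l h1 h2
  exact ⟨h1, h2⟩

theorem HasResolution.proj_mem_domain (hL : E.HasResolution (fun l => l) L) {u : ℝ} (hu : 0 ≤ u)
    (f : H) : E.proj u f ∈ L.domain := by
  rw [hL.1]
  refine MemLp.of_bound (by fun_prop) u ?_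
  filter_upwards [E.ae_proj_mem_Icc hu f] with l hl
  rw [Real.norm_of_nonneg hl.1]
  exact hl.2

theorem HasResolution.dense_domain (hL : E.HasResolution (fun l => l) L) :
    Dense (L.domain : Set H) := by
  intro f
  refine mem_closure_of_tendsto (E.tendsto_atTop f) ?_
  filter_upwards [eventually_ge_atTop 0] with u hu
  exact hL.proj_mem_domain hu f

/-- Against `g` in the dense domain, both sides are weak integrals, for the pairs `(E_u h, g)` and
`(h, E_u g)`, which define the same signed measure. -/
theorem HasResolution.apply_proj (hL : E.HasResolution (fun l => l) L) {u : ℝ} (hu : 0 ≤ u)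
    (h : L.domain) : L ⟨E.proj u h, hL.proj_mem_domain hu h⟩ = E.proj u (L h) := by
  refine hL.dense_domain.eq_of_inner_left (𝕜 := ℝ) fun g hg => ?_
  have hgu := hL.proj_mem_domain hu g
  have hhu := hL.proj_mem_domain hu (h : H)
  have h1 := hL.2 ⟨E.proj u h, hhu⟩ ⟨g, hg⟩
  have h2 := hL.2 h ⟨E.proj u g, hgu⟩
  rw [E.inner_proj_left hu]
  simp only at h1 h2
  rw [h1, h2]
  refine E.weakIntegral_congr (fun l hl => ?_) (hL.integrable (add_mem hhu hg))
    (hL.integrable (sub_mem hhu hg)) (hL.integrable (add_mem h.2 hgu))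
    (hL.integrable (sub_mem h.2 hgu))
  rw [E.proj_comm hl hu, E.inner_proj_left hu]

theorem HasResolution.integrable_add_const (hL : E.HasResolution (fun l => l) L) (α : ℝ)
    (h : L.domain) : Integrable (fun l => l + α) (E.measure (h : H)) :=
  (hL.integrable h.2).add (integrable_const α)

theorem HasResolution.inner_apply_self (hL : E.HasResolution (fun l => l) L) (α : ℝ)
    (h : L.domain) : inner ℝ (L h + α • (h : H)) (h : H) = ∫ l, (l + α) ∂E.measure (h : H) := by
  rw [inner_add_left, real_inner_smul_left, hL.2, E.weakIntegral_self,
    integral_add (hL.integrable h.2) (integrable_const α), integral_const, E.measureReal_univ,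
    real_inner_self_eq_norm_sq, smul_eq_mul, mul_comm α]

theorem HasResolution.inner_proj_apply (hL : E.HasResolution (fun l => l) L) (α : ℝ) {u : ℝ}
    (hu : 0 ≤ u) (h : L.domain) :
    inner ℝ (E.proj u h) (L h + α • (h : H)) = ∫ l in Iic u, (l + α) ∂E.measure (h : H) := by
  have h1 := hL.inner_apply_self α ⟨E.proj u h, hL.proj_mem_domain hu h⟩
  rw [hL.apply_proj hu, ← map_smul, ← map_add, E.measure_proj hu] at h1
  rw [← h1, E.inner_proj_left hu (L h + α • (h : H)), E.proj_proj_of_le hu le_rfl, real_inner_comm]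

/-- The vector `f = (L + α)h` need not lie in the domain, but its truncation `E_u f = (L + α)k` with
`k = E_u h` does. So the weak formula applies to `(k, E_u f)`, where `d(E_l k, E_u f) = (l + α)
d(E_l k, k)`. -/
theorem HasResolution.inner_proj_apply_self (hL : E.HasResolution (fun l => l) L) {α u : ℝ}
    (hα : 0 < α) (hu : 0 ≤ u) (h : L.domain) :
    inner ℝ (E.proj u (L h + α • (h : H))) (L h + α • (h : H))
      = ∫ l in Iic u, (l + α) * (l + α) ∂E.measure (h : H) := by
  obtain ⟨f, hf⟩ : ∃ f, f = L h + α • (h : H) := ⟨_, rfl⟩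
  obtain ⟨k, hk⟩ : ∃ k : L.domain, (k : H) = E.proj u h ∧ L k = E.proj u (L h) :=
    ⟨⟨_, hL.proj_mem_domain hu h⟩, rfl, hL.apply_proj hu h⟩
  have hkf : L k + α • (k : H) = E.proj u f := by
    rw [hk.1, hk.2, hf, map_add, map_smul]
  have hfu : E.proj u f ∈ L.domain := hL.proj_mem_domain hu f
  have hsum : E.weakIntegral (fun l => l) k (E.proj u f)
      = ∫ l, l * (l + α) ∂E.measure (k : H) := by
    refine E.weakIntegral_eq_integral_mul (hL.integrable_add_const α k) ?_ (fun l hl => ?_)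
      (hL.integrable (add_mem k.2 hfu)) (hL.integrable (sub_mem k.2 hfu))
    · filter_upwards [E.ae_nonneg (k : H)] with l hl
      exact add_nonneg hl hα.le
    · rw [← hkf]
      exact hL.inner_proj_apply α hl k
  have hsq : Integrable (fun l => l * l) (E.measure (k : H)) := by
    have := ((hL.1 k).1 k.2).integrable_sq
    simpa only [sq] using this
  have hmul : Integrable (fun l => l * (l + α)) (E.measure (k : H)) := by
    refine (hsq.add ((hL.integrable k.2).mul_const α)).congr (Eventually.of_forall fun l => ?_)
    simp only [Pi.add_apply]
    ring
  have h1 : inner ℝ (E.proj u f) f = inner ℝ (L k + α • (k : H)) (E.proj u f) := by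
    rw [hkf, ← E.inner_proj_left hu, E.proj_proj_of_le hu le_rfl]
  have h2 : inner ℝ (k : H) (E.proj u f) = ∫ l, (l + α) ∂E.measure (k : H) := by
    rw [← hkf, real_inner_comm]
    exact hL.inner_apply_self α k
  rw [← hf, h1, inner_add_left, real_inner_smul_left, h2, hL.2 k ⟨_, hfu⟩, hsum,
    ← integral_const_mul, ← integral_add hmul ((hL.integrable_add_const α k).const_mul α),
    ← E.measure_proj hu, ← hk.1]
  refine integral_congr_ae (Eventually.of_forall fun l => ?_)
  simp only
  ring

theorem HasResolution.measure_apply (hL : E.HasResolution (fun l => l) L) {α : ℝ}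
    (hα : 0 < α) (h : L.domain) :
    E.measure (L h + α • (h : H))
      = (E.measure (h : H)).withDensity fun l => ENNReal.ofReal ((l + α) * (l + α)) := by
  have hint : Integrable (fun l => (l + α) * (l + α)) (E.measure (h : H)) := by
    have h1 : MemLp (fun l => l + α) 2 (E.measure (h : H)) :=
      ((hL.1 h).1 h.2).add (memLp_const α)
    simpa only [sq] using h1.integrable_sq
  have hfin := isFiniteMeasure_withDensity_ofReal hint.2
  refine ext_of_Iic_of_nonneg (E.measure_Iio_zero _) ?_ fun l hl => ?_
  · exact withDensity_absolutelyContinuous _ _ (E.measure_Iio_zero _)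
  · rw [E.measureReal_Iic hl, hL.inner_proj_apply_self hα hl, measureReal_def,
      withDensity_apply _ measurableSet_Iic,
      ← integral_eq_lintegral_of_nonneg_ae (Eventually.of_forall fun x => mul_self_nonneg _)
        hint.aestronglyMeasurable.restrict]

/-- If `L = ∫ l dE_l` and `f = (L + α) h`, then `∫ (l + α)⁻¹ d(E_l f, f) = (f, h)`. -/
theorem HasResolution.integral_inv_measure_apply (hL : E.HasResolution (fun l => l) L) {α : ℝ}
    (hα : 0 < α) (h : L.domain) :
    ∫ l, (l + α)⁻¹ ∂E.measure (L h + α • (h : H)) = inner ℝ (L h + α • (h : H)) (h : H) := by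
  -- Both sides equal `∫ (l + α) d(E_l h, h)`.
  rw [hL.inner_apply_self, hL.measure_apply hα, integral_withDensity_eq_integral_toReal_smul
    (by fun_prop) (Eventually.of_forall fun l => ENNReal.ofReal_lt_top)]
  refine integral_congr_ae ?_
  filter_upwards [E.ae_nonneg (h : H)] with l hl
  have : l + α ≠ 0 := (add_pos_of_nonneg_of_pos hl hα).ne'
  rw [ENNReal.toReal_ofReal (mul_self_nonneg _), smul_eq_mul]
  field_simp

theorem ae_norm_inv_pow_le (E : SpectralFamily H) {α : ℝ} (hα : 0 < α) (n : ℕ) (f : H) :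
    ∀ᵐ l ∂E.measure f, ‖(l + α)⁻¹ ^ n‖ ≤ (1 / α) ^ n := by
  filter_upwards [E.ae_nonneg f] with l hl
  have : 0 < l + α := add_pos_of_nonneg_of_pos hl hα
  rw [Real.norm_of_nonneg (by positivity), one_div]
  gcongr
  linarith

theorem integrable_inv_pow (E : SpectralFamily H) {α : ℝ} (hα : 0 < α) (n : ℕ) (f : H) :
    Integrable (fun l => (l + α)⁻¹ ^ n) (E.measure f) :=
  Integrable.of_bound (by fun_prop) _ (E.ae_norm_inv_pow_le hα n f)

section Resolvent

variable {α : ℝ} {R : H →L[ℝ] H}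

/-- A bounded inverse of `L + α` commutes with the spectral projections of `L`. -/
theorem HasResolution.inverse_proj (hL : E.HasResolution (fun l => l) L)
    (hR : ∀ f, ∃ h : L.domain, (h : H) = R f ∧ L h + α • (h : H) = f)
    (hR' : ∀ h : L.domain, R (L h + α • (h : H)) = h) {u : ℝ} (hu : 0 ≤ u) (f : H) :
    R (E.proj u f) = E.proj u (R f) := by
  obtain ⟨h, hh, hf⟩ := hR f
  have key := hR' ⟨_, hL.proj_mem_domain hu h⟩
  rw [hL.apply_proj hu, ← map_smul, ← map_add, hf] at key
  rw [← hh]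
  exact key

/-- Induction on `(R^(n+1) f, f) = (Rⁿ f, R f)`: since `R` commutes with `E_l`, `(E_l f, R f) = (R
E_l f, E_l f)`, so the case of exponent one gives `d(E_l f, R f) = (l + α)⁻¹ d(E_l f, f)`. -/
theorem HasResolution.inner_inverse_pow (hL : E.HasResolution (fun l => l) L) (hα : 0 < α)
    (hRs : IsSelfAdjoint R)
    (hR : ∀ f, ∃ h : L.domain, (h : H) = R f ∧ L h + α • (h : H) = f)
    (hR' : ∀ h : L.domain, R (L h + α • (h : H)) = h) (n : ℕ) (f : H) :
    inner ℝ ((R ^ n) f) f = ∫ l, (l + α)⁻¹ ^ n ∂E.measure f := by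
  have hone : ∀ f, inner ℝ (R f) f = ∫ l, (l + α)⁻¹ ∂E.measure f := by
    intro f
    obtain ⟨h, hh, hf⟩ := hR f
    rw [← hf, hL.integral_inv_measure_apply hα, hR', real_inner_comm]
  have hsymm : ∀ f g, inner ℝ (R f) g = inner ℝ f (R g) :=
    ContinuousLinearMap.isSelfAdjoint_iff_isSymmetric.1 hRs
  induction n generalizing f with
  | zero => simp [E.measureReal_univ]
  | succ n ih =>
    have hinv : Integrable (fun l => (l + α)⁻¹) (E.measure f) := by
      simpa using E.integrable_inv_pow hα 1 f
    rw [pow_succ', mul_apply_eq_comp, hsymm, E.weakIntegral_eq_inner (hRs.pow n) ih,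
      E.weakIntegral_eq_integral_mul (φ := fun l => (l + α)⁻¹) hinv ?_ (fun l hl => ?_)
        (E.integrable_inv_pow hα n _) (E.integrable_inv_pow hα n _)]
    · simp_rw [pow_succ]
    · filter_upwards [E.ae_nonneg f] with l hl
      exact inv_nonneg.2 (add_nonneg hl hα.le)
    · rw [← E.measure_proj hl, ← hone, hL.inverse_proj hR hR' hl,
        E.inner_proj_left hl (R f), E.proj_proj_of_le hl le_rfl, real_inner_comm]

theorem HasResolution.inner_inverse_mul_exp (hL : E.HasResolution (fun l => l) L) (hα : 0 < α)
    (hRs : IsSelfAdjoint R)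
    (hR : ∀ f, ∃ h : L.domain, (h : H) = R f ∧ L h + α • (h : H) = f)
    (hR' : ∀ h : L.domain, R (L h + α • (h : H)) = h) (t : ℝ) (f : H) :
    inner ℝ ((R * NormedSpace.exp ((-t) • R)) f) f
      = ∫ l, 1 / (l + α) * Real.exp (-t / (l + α)) ∂E.measure f := by
  have h1 : HasSum (fun k : ℕ => (-t) ^ k / (Nat.factorial k : ℝ) *
      ∫ l, (l + α)⁻¹ ^ (k + 1) ∂E.measure f) (inner ℝ ((R * NormedSpace.exp ((-t) • R)) f) f) := by
    have h := (((NormedSpace.exp_series_hasSum_exp' (𝕂 := ℝ) ((-t) • R)).mul_left R).mapL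
      (ContinuousLinearMap.apply ℝ H f)).mapL (innerSL ℝ f)
    simp only [ContinuousLinearMap.apply_apply, innerSL_apply_apply] at h
    rw [real_inner_comm]
    refine h.congr_fun fun k => ?_
    rw [smul_pow, smul_smul, mul_smul_comm, ← pow_succ', smul_apply, real_inner_smul_right,
      real_inner_comm, hL.inner_inverse_pow hα hRs hR hR']
    ring
  have h2 := (integrable_and_hasSum_integral (μ := E.measure f)
    (F := fun (k : ℕ) l => (-t) ^ k / (Nat.factorial k : ℝ) * (l + α)⁻¹ ^ (k + 1))
    (g := fun l => 1 / (l + α) * Real.exp (-t / (l + α)))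
    (fun k => (E.integrable_inv_pow hα (k + 1) f).const_mul _) ?_ ?_).2
  · simp_rw [integral_const_mul] at h2
    exact h1.unique h2
  · refine Summable.of_nonneg_of_le (fun k => integral_nonneg fun s => norm_nonneg _) (fun k => ?_)
      ((Real.summable_pow_div_factorial (|t| * (1 / α))).mul_right ((1 / α) * ‖f‖ ^ 2))
    calc ∫ l, ‖(-t) ^ k / (Nat.factorial k : ℝ) * (l + α)⁻¹ ^ (k + 1)‖ ∂E.measure f
        ≤ ∫ _, |t| ^ k / (Nat.factorial k : ℝ) * (1 / α) ^ (k + 1) ∂E.measure f := by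
          refine integral_mono_ae ((E.integrable_inv_pow hα (k + 1) f).const_mul _).norm
            (integrable_const _) ?_
          filter_upwards [E.ae_norm_inv_pow_le hα (k + 1) f] with l hl
          rw [norm_mul, norm_div, norm_pow (-t), norm_neg, Real.norm_eq_abs t,
            Real.norm_of_nonneg (Nat.cast_nonneg _)]
          gcongr
      _ = (|t| * (1 / α)) ^ k / (Nat.factorial k : ℝ) * ((1 / α) * ‖f‖ ^ 2) := by
          rw [integral_const, E.measureReal_univ, smul_eq_mul]
          ring
  · refine Eventually.of_forall fun l => ?_
    have h := ((NormedSpace.exp_series_hasSum_exp' (𝕂 := ℝ) (-t / (l + α))).mul_left (1 / (l + α)))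
    rw [← Real.exp_eq_exp_ℝ] at h
    refine h.congr_fun fun k => ?_
    rw [smul_eq_mul]
    ring

/-- For `t ≥ 0` the symbol is bounded by `1/α` on `[0, ∞)`, so the domain condition holds for every
vector; polarisation does the rest. -/
theorem HasResolution.inverse_mul_exp (hL : E.HasResolution (fun l => l) L) (hα : 0 < α)
    (hRs : IsSelfAdjoint R)
    (hR : ∀ f, ∃ h : L.domain, (h : H) = R f ∧ L h + α • (h : H) = f)
    (hR' : ∀ h : L.domain, R (L h + α • (h : H)) = h) {t : ℝ} (ht : 0 ≤ t)
    {T : H →L[ℝ] H} (hT : T = R * NormedSpace.exp ((-t) • R)) (hTs : IsSelfAdjoint T) :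
    E.HasResolution (fun l => 1 / (l + α) * Real.exp (-t / (l + α)))
      ((T : H →ₗ[ℝ] H).toPMap ⊤) := by
  refine ⟨fun f => ⟨fun _ => ?_, fun _ => Submodule.mem_top⟩, fun f g => ?_⟩
  · refine MemLp.of_bound (by fun_prop) (1 / α) ?_
    filter_upwards [E.ae_nonneg f] with l hl
    have hlα : 0 < l + α := add_pos_of_nonneg_of_pos hl hα
    rw [Real.norm_of_nonneg (by positivity)]
    have h1 : 1 / (l + α) ≤ 1 / α := one_div_le_one_div_of_le hα (by linarith)
    have h2 : Real.exp (-t / (l + α)) ≤ 1 :=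
      Real.exp_le_one_iff.2 (div_nonpos_of_nonpos_of_nonneg (neg_nonpos.2 ht) hlα.le)
    calc 1 / (l + α) * Real.exp (-t / (l + α)) ≤ 1 / α * 1 := by gcongr
      _ = 1 / α := mul_one _
  · refine E.weakIntegral_eq_inner hTs (fun f => ?_) f g
    rw [hT]
    exact hL.inner_inverse_mul_exp hα hRs hR hR' t f

end Resolvent

end SpectralFamily

end

/-! ### The main theorem. -/

theorem proposition2p4 {X : Type*} [MeasurableSpace X] (m : Measure X)
    (P : ℝ → L2 m →L[ℝ] L2 m) (hP : IsSymmetricSubMarkovSemigroup m P)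
    (α : ℝ) (hα : 0 < α) :
    (∀ t : ℝ, 0 ≤ t →
      (∀ f : L2 m, IntegrableOn (besselIntegrand P α t f) (Ioi 0)) ∧
      ∃ T : L2 m →L[ℝ] L2 m,
        (∀ f : L2 m, T f = besselTransform P α t f) ∧
        IsSelfAdjoint T ∧
        (∀ f : L2 m, 0 ≤ inner ℝ (T f) f) ∧
        ∀ E : SpectralFamily (L2 m),
          E.HasResolution (fun l => l) (-generator P) →
          E.HasResolution (fun l => 1 / (l + α) * Real.exp (-t / (l + α)))
            ((T : L2 m →ₗ[ℝ] L2 m).toPMap ⊤)) ∧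
    (∀ f : L2 m,
      ConvexOn ℝ (Ici 0) (fun t : ℝ => (inner ℝ (besselTransform P α t f) f : ℝ)) ∧
      AntitoneOn (fun t : ℝ => (inner ℝ (besselTransform P α t f) f : ℝ)) (Ici 0) ∧
      Tendsto (fun t : ℝ => (inner ℝ (besselTransform P α t f) f : ℝ)) atTop (𝓝 0)) := by
  have hC := hP.isSymmetricContractionSemigroup
  have hRs := hC.isSelfAdjoint_resolvent hα
  have hpos := hC.inner_resolvent_nonneg hα
  have hR : ∀ f, ∃ h : (-generator P).domain, (h : L2 m) = hC.resolvent hα f ∧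
      (-generator P) h + α • (h : L2 m) = f := by
    intro f
    obtain ⟨hf, hgen⟩ := hC.generator_resolvent hα f
    refine ⟨⟨_, hf⟩, rfl, ?_⟩
    rw [LinearPMap.neg_apply]
    exact (congrArg (fun g => -g + α • hC.resolvent hα f) hgen).trans (by simp)
  have hR' : ∀ h : (-generator P).domain,
      hC.resolvent hα ((-generator P) h + α • (h : L2 m)) = h := by
    intro h
    rw [LinearPMap.neg_apply, neg_add_eq_sub]
    exact hC.resolvent_apply_sub_generator hα h
  have hTs : ∀ t : ℝ, IsSelfAdjoint
      (hC.resolvent hα * NormedSpace.exp ((-t) • hC.resolvent hα)) := fun t =>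
    -- A product of commuting self-adjoint operators is self-adjoint.
    (hRs.commute_iff ((IsSelfAdjoint.all (-t)).smul hRs).exp).1
      ((Commute.refl _).smul_right _).exp_right
  refine ⟨fun t ht => ⟨fun f => (hC.integrableOn_besselIntegrand_and_hasSum hα ht f).1,
    hC.resolvent hα * NormedSpace.exp ((-t) • hC.resolvent hα),
    fun f => (hC.besselTransform_eq hα ht f).symm, hTs t, fun f => ?_, fun E hE => ?_⟩, fun f => ?_⟩
  · simpa using inner_pow_mul_exp_apply_nonneg hRs hpos 1 t f
  · refine hE.inverse_mul_exp hα hRs hR hR' ht rfl (hTs t)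
  · have heq : EqOn (fun t : ℝ => (inner ℝ (besselTransform P α t f) f : ℝ))
        (fun t => inner ℝ ((hC.resolvent hα ^ 1 *
          NormedSpace.exp ((-t) • hC.resolvent hα)) f) f) (Ici 0) := by
      intro t ht
      simp only [pow_one]
      rw [hC.besselTransform_eq hα ht]
    refine ⟨?_, ?_, ?_⟩
    · exact ((convexOn_inner_pow_mul_exp hRs hpos 1 f).subset (subset_univ _)
        (convex_Ici 0)).congr heq.symm
    · exact ((antitone_inner_pow_mul_exp hRs hpos 1 f).antitoneOn _).congr heq.symm
    -- Index 0 here, not 1: the decay lemma concerns the power `n + 1`.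
    · refine (tendsto_inner_pow_mul_exp hRs hpos 0 f).congr' ?_
      filter_upwards [eventually_ge_atTop 0] with t ht
      exact (heq ht).symm
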